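/- Consider $N\ge 1$ parallel queues and one server in slotted time $t=0,1,2,\dots$. In slot $t$, $A_i(t)\in\{0,1,2,\dots\}$ packets arrive at queue $i$ (available for service from slot $t+1$ on), and the channel of queue $i$ is ON if $C_i(t)=1$ and OFF if $C_i(t)=0$. For each $i$, the variables $A_i(t)$, $t\ge 0$, are i.i.d. with mean $\lambda_i$ and finite second moment; the variables $C_i(t)$, $t\ge 0$, are i.i.d. with $\mathbb P(C_i(t)=1)=p_i\in(0,1]$; and the processes $A_1,\dots,A_N,C_1,\dots,C_N$ are independent. In a slot that the server spends at queue $i$ without starting to move, one packet leaves queue $i$ if $C_i(t)=1$ and the queue is non-empty. Moving from queue $i$ to queue $j\neq i$ takes a constant number $d_{ij}\ge 1$ of slots without service. A control algorithm decides in each slot in which the server is at a queue whether to stay or to start moving to some queue, on the basis of the earlier arrivals, the past and current channel states, and possibly private randomization independent of the present and future arrivals and channel states. (A move from a queue to itself, which occurs in the cyclic order only if $N=1$, takes $\max(d_{ii},1)$ slots.) The initial queue lengths and initial position of the server are arbitrary and deterministic. The system is called stable if $\limsup_{t\to\infty}\frac1t\sum_{\tau=0}^{t-1}\mathbb E[Q_i(\tau)]<\infty$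 for every $i$, where $Q_i(\tau)$ is the length of queue $i$ at the beginning of slot $\tau$. Let $\rho=\sum_{i=1}^N\lambda_i/p_i$. The cyclic Gated policy visits the queues in the cyclic order $1\to2\to\cdots\to N\to1$; at each visit the server stays exactly until all the packets that were present upon its arrival at the queue have been transmitted, and then moves to the next queue. 1. If $\rho<1$, the cyclic Gated policy is a control algorithm that stabilizes the system. 2. Conversely, if some control algorithm stabilizes the system, then $\rho\le 1$. 3. Consequently, let $\mathbf\Lambda$ be the stability region, i.e. the set of rate vectors $(\lambda_1,\dots,\lambda_N)\in[0,\infty)^N$ such that every system as above with these rates is stabilized by some control algorithm, from every initial state. Up to its boundary $\mathbf\Lambda$ is given by $\rho\le1$, that is, $$\overline{\mathbf\Lambda}=\Big\{(\lambda_1,\dots,\lambda_N)\in[0,\infty)^N:\ \sum_{i=1}^N\frac{\lambda_i}{p_i}\le1\Big\}.$$ -/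

import Mathlib

open MeasureTheory ProbabilityTheory Filter
open scoped ENNReal

namespace SwitchedQueues

/-- State of the system at the beginning of a slot. If `travel = 0`, the server is at queue `loc`;
if `travel > 0`, the server is on its way to queue `loc` and needs `travel` more slots. -/
structure State (N : ℕ) where
  queue : Fin N → ℕ
  loc : Fin N
  travel : ℕ

/-- One slot of the system. `a i` is the number of arrivals to queue `i` during the slot, and the
channel of queue `i` is ON iff `c i = 1`. The action `u` matters only when the server is at a
queue: `none` means that it stays (and then transmits one packet of that queue, if there is one
and the channel is ON), `some j` means that it starts to move to queue `j`, which occupies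
`d loc j ≥ 1` slots including the present one. Nothing is transmitted during a move. -/
def step {N : ℕ} (d : Fin N → Fin N → ℕ) (x : State N) (u : Option (Fin N))
    (a c : Fin N → ℕ) : State N :=
  if 0 < x.travel then
    ⟨fun i => x.queue i + a i, x.loc, x.travel - 1⟩
  else
    match u with
    | none =>
        ⟨fun i => x.queue i - (if i = x.loc ∧ c i = 1 then 1 else 0) + a i, x.loc, 0⟩
    | some j => ⟨fun i => x.queue i + a i, j, d x.loc j - 1⟩

/-- The trajectory under a sequence of actions `u`, along arrival and channel paths `a`, `c`
(indexed by queue and slot), from queue lengths `q₀` with the server at queue `i₀`. -/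
def run {N : ℕ} (d : Fin N → Fin N → ℕ) (q₀ : Fin N → ℕ) (i₀ : Fin N)
    (u : ℕ → Option (Fin N)) (a c : Fin N → ℕ → ℕ) : ℕ → State N
  | 0 => ⟨q₀, i₀, 0⟩
  | t + 1 => step d (run d q₀ i₀ u a c t) (u t) (fun i => a i t) (fun i => c i t)

/-- The action of the cyclic gated policy, where `g` is the number of packets that were present
when the server arrived at its current queue and have not been transmitted yet: stay as long as
there are such packets, then move to the next queue in the cyclic order
`0 → 1 → ⋯ → N - 1 → 0` (addition in `Fin N`). -/
def gatedAction {N : ℕ} [NeZero N] (x : State N) (g : ℕ) : Option (Fin N) :=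
  if g = 0 then some (x.loc + 1) else none

/-- One slot of the system under the cyclic gated policy, with the count of the remaining gated
packets. When the server arrives at a queue, the count is set to the current length of that queue;
during service it decreases by one with each transmitted packet. -/
def gatedStep {N : ℕ} [NeZero N] (d : Fin N → Fin N → ℕ) (y : State N × ℕ)
    (a c : Fin N → ℕ) : State N × ℕ :=
  let x' := step d y.1 (gatedAction y.1 y.2) a c
  (x',
    if 0 < y.1.travel ∨ y.2 = 0 then
      (if x'.travel = 0 then x'.queue x'.loc else 0)
    else if c y.1.loc = 1 then y.2 - 1 else y.2)

/-- State and remaining gated packets under the cyclic gated policy. -/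
def gatedRun {N : ℕ} [NeZero N] (d : Fin N → Fin N → ℕ) (q₀ : Fin N → ℕ) (i₀ : Fin N)
    (a c : Fin N → ℕ → ℕ) : ℕ → State N × ℕ
  | 0 => (⟨q₀, i₀, 0⟩, q₀ i₀)
  | t + 1 => gatedStep d (gatedRun d q₀ i₀ a c t) (fun i => a i t) (fun i => c i t)

/-- The sequence of actions chosen by the cyclic gated policy. -/
def gatedControl {N : ℕ} [NeZero N] (d : Fin N → Fin N → ℕ) (q₀ : Fin N → ℕ) (i₀ : Fin N)
    (a c : Fin N → ℕ → ℕ) (t : ℕ) : Option (Fin N) :=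
  gatedAction (gatedRun d q₀ i₀ a c t).1 (gatedRun d q₀ i₀ a c t).2

/-- The arrival processes `A i` (i.i.d. over time, rate `lam i`, finite second moment) and the
channel processes `C i` (i.i.d. over time, ON with probability `p i`), all independent of each
other. -/
structure IsModel {N : ℕ} {Ω : Type*} [MeasurableSpace Ω] (μ : Measure Ω)
    (lam p : Fin N → ℝ) (A C : Fin N → ℕ → Ω → ℕ) : Prop where
  measurable_arrival : ∀ i t, Measurable (A i t)
  measurable_channel : ∀ i t, Measurable (C i t)
  indep : iIndepFun
    (Sum.elim (fun k : Fin N × ℕ => A k.1 k.2) (fun k : Fin N × ℕ => C k.1 k.2)) μ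
  identDistrib_arrival : ∀ i t, IdentDistrib (A i t) (A i 0) μ μ
  memLp_arrival : ∀ i t, MemLp (fun ω => (A i t ω : ℝ)) 2 μ
  mean_arrival : ∀ i t, ∫ ω, (A i t ω : ℝ) ∂μ = lam i
  channel_zero_or_one : ∀ i t ω, C i t ω = 0 ∨ C i t ω = 1
  prob_on : ∀ i t, μ.real {ω | C i t ω = 1} = p i

/-- The information in the channel states of slot `t`. -/
@[reducible] def channelInfo {N : ℕ} {Ω : Type*} (C : Fin N → ℕ → Ω → ℕ) (t : ℕ) : MeasurableSpace Ω :=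
  ⨆ i, MeasurableSpace.comap (C i t) ⊤

/-- The information in the arrivals and the channel states of slot `t`. -/
@[reducible] def slotInfo {N : ℕ} {Ω : Type*} (A C : Fin N → ℕ → Ω → ℕ) (t : ℕ) : MeasurableSpace Ω :=
  (⨆ i, MeasurableSpace.comap (A i t) ⊤) ⊔ channelInfo C t

/-- Control algorithms, possibly randomized: the action in slot `t` depends on the arrivals and
channel states of earlier slots, on the current channel states, and on further information (such
as private randomness) that is independent of the present and future arrivals and channels. -/
def IsControl {N : ℕ} {Ω : Type*} [mΩ : MeasurableSpace Ω] (μ : Measure Ω)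
    (A C : Fin N → ℕ → Ω → ℕ) (u : ℕ → Ω → Option (Fin N)) : Prop :=
  ∃ ℱ : Filtration ℕ mΩ,
    (∀ s t, s < t → slotInfo A C s ≤ ℱ t) ∧
    (∀ t, Indep (ℱ t) (⨆ s : ℕ, ⨆ _ : t ≤ s, slotInfo A C s) μ) ∧
    (∀ t v, MeasurableSet[ℱ t ⊔ channelInfo C t] {ω | u t ω = v})

/-- `limsup_{t → ∞} (1 / t) ∑_{τ < t} E[Q(τ)] < ∞`, with expectations in `[0, ∞]`. -/
def StronglyStable {Ω : Type*} [MeasurableSpace Ω] (μ : Measure Ω) (Q : ℕ → Ω → ℕ) : Prop :=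
  limsup (fun t : ℕ => (∑ τ ∈ Finset.range t, ∫⁻ ω, (Q τ ω : ℝ≥0∞) ∂μ) / (t : ℝ≥0∞)) atTop < ⊤

/-- All queues are strongly stable under the actions `u`. -/
def Stabilizes {N : ℕ} {Ω : Type*} [MeasurableSpace Ω] (μ : Measure Ω)
    (d : Fin N → Fin N → ℕ) (q₀ : Fin N → ℕ) (i₀ : Fin N) (A C : Fin N → ℕ → Ω → ℕ)
    (u : ℕ → Ω → Option (Fin N)) : Prop :=
  ∀ i, StronglyStable μ fun t ω =>
    (run d q₀ i₀ (fun s => u s ω) (fun j s => A j s ω) (fun j s => C j s ω) t).queue i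

/-- The system load. -/
noncomputable def load {N : ℕ} (lam p : Fin N → ℝ) : ℝ := ∑ i, lam i / p i

/-- The set of all arrival rate vectors for which there is a control algorithm that stabilizes the
system (whatever the arrival processes with these rates and the initial state are). -/
def stabilityRegion {N : ℕ} (p : Fin N → ℝ) (d : Fin N → Fin N → ℕ) : Set (Fin N → ℝ) :=
  {lam | (∀ i, 0 ≤ lam i) ∧
    ∀ (Ω : Type) [MeasurableSpace Ω] (μ : Measure Ω) [IsProbabilityMeasure μ]
      (A C : Fin N → ℕ → Ω → ℕ), IsModel μ lam p A C →
      ∀ (q₀ : Fin N → ℕ) (i₀ : Fin N),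
        ∃ u : ℕ → Ω → Option (Fin N), IsControl μ A C u ∧ Stabilizes μ d q₀ i₀ A C u}

end SwitchedQueues

/-! Measure the backlog in work: a packet at queue `i` costs `1 / p i` slots of service on average,
so work arrives at mean rate `load lam p` and is served at mean rate at most one.

Sufficiency is a drift argument with the function `lyapunov`, which works slot by slot and needs no
analysis of cycles. Work at a queue that the server reaches after `k` more departures has weight `1
- ε + ε * k`. At the current queue the gated packets have `k = 0`, while the others must wait for
the next visit; the additional term gives them `k = N`. Hence every departure lowers the weight of
all present work by `ε`, a gain proportional to the whole backlog, at the price of a bounded travel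
time. In a slot of travel the function loses 1, in a slot of service `1 - ε` on average, and
arrivals add at most `(1 + ε * N) * load lam p` on average. For small `ε` the net drift is negative
during travel and service, and at departures the function contracts up to a bounded mean increase.
Finite second moments turn this into a drift of the square, bounded by a constant minus a multiple
of the function (`IsModel.exists_drift`); telescoping bounds the time averages
(`IsModel.stronglyStable_gated`).

Necessity: the position of the server in a slot is independent of the channels of that slot, so mean
work drops by at most one per slot through service (`IsModel.lintegral_queue_succ`). If the load
exceeds one, mean work grows linearly, which contradicts bounded time averages
(`IsModel.load_le_one_of_stabilizes`).

The region then follows by scaling rates into the interior and by the existence of a model for all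
rates. -/

namespace SwitchedQueues


/-! ### Information structure and measurability of the gated policy -/

section Measurability

variable {N : ℕ} {Ω : Type*}

instance : MeasurableSpace (State N) := ⊤

instance : DiscreteMeasurableSpace (State N) := ⟨fun _ => trivial⟩

instance : Countable (State N) := by
  have h : Function.Injective
      (fun x : State N => (x.queue, x.loc, x.travel)) := by
    rintro ⟨q, l, r⟩ ⟨q', l', r'⟩ h
    simpa using h
  exact h.countable

/-- The arrivals and channel states of slot `t`. -/
def slotVar (A C : Fin N → ℕ → Ω → ℕ) (t : ℕ) (ω : Ω) : (Fin N → ℕ) × (Fin N → ℕ) :=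
  (fun i => A i t ω, fun i => C i t ω)

/-- The information in the arrivals and channel states of the slots before `t`. -/
@[reducible] def pastInfo (A C : Fin N → ℕ → Ω → ℕ) (t : ℕ) : MeasurableSpace Ω :=
  ⨆ s : ℕ, ⨆ _ : s < t, slotInfo A C s

theorem slotInfo_le_pastInfo (A C : Fin N → ℕ → Ω → ℕ) {s t : ℕ} (h : s < t) :
    slotInfo A C s ≤ pastInfo A C t :=
  le_iSup₂_of_le s h le_rfl

theorem pastInfo_mono (A C : Fin N → ℕ → Ω → ℕ) : Monotone (pastInfo A C) := fun _ _ h =>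
  iSup₂_le fun _ hs => slotInfo_le_pastInfo A C (hs.trans_le h)

theorem measurable_arrival_slotInfo (A C : Fin N → ℕ → Ω → ℕ) (i : Fin N) (t : ℕ) :
    Measurable[slotInfo A C t] (A i t) :=
  measurable_iff_comap_le.2
    (le_sup_of_le_left (le_iSup (fun i => MeasurableSpace.comap (A i t) ⊤) i))

theorem measurable_channel_slotInfo (A C : Fin N → ℕ → Ω → ℕ) (i : Fin N) (t : ℕ) :
    Measurable[slotInfo A C t] (C i t) :=
  measurable_iff_comap_le.2
    (le_sup_of_le_right (le_iSup (fun i => MeasurableSpace.comap (C i t) ⊤) i))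

theorem measurable_slotVar (A C : Fin N → ℕ → Ω → ℕ) (t : ℕ) :
    Measurable[slotInfo A C t] (slotVar A C t) := by
  let _ := slotInfo A C t
  exact (measurable_pi_lambda _ fun i => measurable_arrival_slotInfo A C i t).prodMk
    (measurable_pi_lambda _ fun i => measurable_channel_slotInfo A C i t)

variable {mΩ : MeasurableSpace Ω} {μ : Measure Ω} {lam p : Fin N → ℝ} {A C : Fin N → ℕ → Ω → ℕ}

theorem IsModel.slotInfo_le (h : IsModel μ lam p A C) (t : ℕ) : slotInfo A C t ≤ mΩ :=
  sup_le (iSup_le fun i => (h.measurable_arrival i t).comap_le)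
    (iSup_le fun i => (h.measurable_channel i t).comap_le)

theorem IsModel.pastInfo_le (h : IsModel μ lam p A C) (t : ℕ) : pastInfo A C t ≤ mΩ :=
  iSup₂_le fun s _ => h.slotInfo_le s

theorem IsModel.rate_nonneg (h : IsModel μ lam p A C) (i : Fin N) : 0 ≤ lam i := by
  rw [← h.mean_arrival i 0]
  exact integral_nonneg fun ω => Nat.cast_nonneg _

/-- Past and future are generated by disjoint subfamilies of one independent family. -/
theorem IsModel.indep_pastInfo (h : IsModel μ lam p A C) (t : ℕ) :
    Indep (pastInfo A C t) (⨆ s : ℕ, ⨆ _ : t ≤ s, slotInfo A C s) μ := by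
  set X := Sum.elim (fun k : Fin N × ℕ => A k.1 k.2) (fun k : Fin N × ℕ => C k.1 k.2) with hX
  set m : (Fin N × ℕ) ⊕ (Fin N × ℕ) → MeasurableSpace Ω :=
    fun k => MeasurableSpace.comap (X k) ⊤ with hm
  let time : (Fin N × ℕ) ⊕ (Fin N × ℕ) → ℕ := Sum.elim Prod.snd Prod.snd
  have hle : ∀ k, m k ≤ mΩ := by
    rintro (k | k)
    · exact (h.measurable_arrival k.1 k.2).comap_le
    · exact (h.measurable_channel k.1 k.2).comap_le
  have hind : iIndep m μ := h.indep
  have key := indep_iSup_of_disjoint hle hind (S := {k | time k < t}) (T := {k | t ≤ time k})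
    (Set.disjoint_left.2 fun k (hk : time k < t) (hk' : t ≤ time k) => absurd hk (not_lt.2 hk'))
  have hslot : ∀ (S : Set ((Fin N × ℕ) ⊕ (Fin N × ℕ))) (s : ℕ), (∀ k, time k = s → k ∈ S) →
      slotInfo A C s ≤ ⨆ k ∈ S, m k := by
    intro S s hS
    refine sup_le (iSup_le fun i => ?_) (iSup_le fun i => ?_)
    · exact le_iSup₂_of_le (f := fun k (_ : k ∈ S) => m k) (Sum.inl (i, s)) (hS _ rfl) le_rfl
    · exact le_iSup₂_of_le (f := fun k (_ : k ∈ S) => m k) (Sum.inr (i, s)) (hS _ rfl) le_rfl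
  refine indep_of_indep_of_le_left (indep_of_indep_of_le_right key ?_) ?_
  · exact iSup₂_le fun s hs => hslot _ s fun k hk => by simpa [hk] using hs
  · exact iSup₂_le fun s hs => hslot _ s fun k hk => by simpa [hk] using hs

theorem measurable_gatedRun [NeZero N] (A C : Fin N → ℕ → Ω → ℕ) (d : Fin N → Fin N → ℕ)
    (q₀ : Fin N → ℕ) (i₀ : Fin N) (t : ℕ) :
    Measurable[pastInfo A C t] (fun ω =>
      gatedRun d q₀ i₀ (fun i s => A i s ω) (fun i s => C i s ω) t) := by
  induction t with
  | zero => exact @measurable_const _ _ _ (pastInfo A C 0) _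
  | succ t ih =>
    let _ := pastInfo A C (t + 1)
    have h1 : Measurable (fun ω =>
        gatedRun d q₀ i₀ (fun i s => A i s ω) (fun i s => C i s ω) t) :=
      ih.mono (pastInfo_mono A C (Nat.le_succ t)) le_rfl
    have h2 : Measurable (slotVar A C t) :=
      (measurable_slotVar A C t).mono (slotInfo_le_pastInfo A C (Nat.lt_succ_self t)) le_rfl
    exact (Measurable.of_discrete (f := fun z : (State N × ℕ) × ((Fin N → ℕ) × (Fin N → ℕ)) =>
      gatedStep d z.1 z.2.1 z.2.2)).comp (h1.prodMk h2)

theorem IsModel.isControl_gatedControl [NeZero N] (h : IsModel μ lam p A C)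
    (d : Fin N → Fin N → ℕ) (q₀ : Fin N → ℕ) (i₀ : Fin N) :
    IsControl μ A C (fun t ω =>
      gatedControl d q₀ i₀ (fun i s => A i s ω) (fun i s => C i s ω) t) := by
  refine ⟨⟨pastInfo A C, pastInfo_mono A C, h.pastInfo_le⟩,
    fun s t hst => slotInfo_le_pastInfo A C hst, h.indep_pastInfo, fun t v => ?_⟩
  -- The gated policy does not look at the current channel states.
  refine le_sup_left (a := pastInfo A C t) _ ?_
  exact measurable_gatedRun A C d q₀ i₀ t
    (MeasurableSet.of_discrete (s := {y : State N × ℕ | gatedAction y.1 y.2 = v}))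

theorem run_gatedControl [NeZero N] (d : Fin N → Fin N → ℕ) (q₀ : Fin N → ℕ) (i₀ : Fin N)
    (a c : Fin N → ℕ → ℕ) (t : ℕ) :
    run d q₀ i₀ (gatedControl d q₀ i₀ a c) a c t = (gatedRun d q₀ i₀ a c t).1 := by
  induction t with
  | zero => rfl
  | succ t ih => rw [run, ih]; rfl

end Measurability

/-- Freezing: this lets a drift bound for each fixed state be integrated over the random state,
which is independent of the next slot. -/
theorem lintegral_comp_prodMk_of_indep {Ω α β : Type*} {mΩ : MeasurableSpace Ω} {μ : Measure Ω}
    [IsProbabilityMeasure μ] [MeasurableSpace α] [MeasurableSpace β] {Y : Ω → α} {Z : Ω → β}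
    (hY : Measurable Y) (hZ : Measurable Z) (hYZ : IndepFun Y Z μ) {f : α × β → ℝ≥0∞}
    (hf : Measurable f) :
    ∫⁻ ω, f (Y ω, Z ω) ∂μ = ∫⁻ ω, ∫⁻ ω', f (Y ω, Z ω') ∂μ ∂μ := by
  have := Measure.isProbabilityMeasure_map (μ := μ) hY.aemeasurable
  have := Measure.isProbabilityMeasure_map (μ := μ) hZ.aemeasurable
  rw [← lintegral_map hf (hY.prodMk hZ),
    (indepFun_iff_map_prod_eq_prod_map_map hY.aemeasurable hZ.aemeasurable).1 hYZ,
    lintegral_prod _ hf.aemeasurable, lintegral_map hf.lintegral_prod_right' hY]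
  exact lintegral_congr fun ω => lintegral_map (hf.comp measurable_prodMk_left) hZ


/-! ### The Lyapunov function and its pathwise one-slot bounds -/

section Lyapunov

variable {N : ℕ}

/-- The cyclic distance from `j` to `i` in the visiting order. -/
def cyclicDist (i j : Fin N) : ℕ := ((i - j : Fin N) : ℕ)

theorem cyclicDist_self [NeZero N] (i : Fin N) : cyclicDist i i = 0 := by
  simp [cyclicDist]

/-- A departure brings every queue one visit closer, except the one being left, whose distance jumps
from `0` to `N - 1`. -/
theorem cyclicDist_succ [NeZero N] (i j : Fin N) :
    (cyclicDist i (j + 1) : ℝ) = cyclicDist i j - 1 + if i = j then (N : ℝ) else 0 := by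
  obtain ⟨n, rfl⟩ := Nat.exists_eq_succ_of_ne_zero (NeZero.ne N)
  have h : i - (j + 1) = (i - j) - 1 := by abel
  unfold cyclicDist
  rw [h, Fin.coe_sub_one]
  by_cases hij : i = j
  · simp [hij]
  · have h0 : i - j ≠ 0 := sub_ne_zero.2 hij
    have h1 : 1 ≤ ((i - j : Fin (n + 1)) : ℕ) :=
      Nat.one_le_iff_ne_zero.2 fun h => h0 (Fin.ext h)
    simp [hij, h0, Nat.cast_sub h1]

/-- The weight of the work at queue `i` while the server is at, or on its way to, queue `j`. -/
noncomputable def weight (ε : ℝ) (i j : Fin N) : ℝ := 1 - ε + ε * cyclicDist i j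

theorem weight_succ [NeZero N] (ε : ℝ) (i j : Fin N) :
    weight ε i (j + 1) = weight ε i j - ε + if i = j then ε * N else 0 := by
  rw [weight, cyclicDist_succ, weight]
  split_ifs <;> ring

theorem weight_self [NeZero N] (ε : ℝ) (i : Fin N) : weight ε i i = 1 - ε := by
  simp [weight, cyclicDist_self]

theorem le_weight {ε : ℝ} (hε : 0 ≤ ε) (i j : Fin N) : 1 - ε ≤ weight ε i j := by
  unfold weight
  have : 0 ≤ ε * cyclicDist i j := by positivity
  linarith

theorem weight_le {ε : ℝ} (hε : 0 ≤ ε) (i j : Fin N) : weight ε i j ≤ 1 + ε * N := by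
  unfold weight
  have : ε * cyclicDist i j ≤ ε * N :=
    mul_le_mul_of_nonneg_left (by exact_mod_cast (i - j : Fin N).isLt.le) hε
  linarith

/-- A Lyapunov function of the system under the cyclic gated policy: a weighted amount of work,
in which the weight of a queue decreases by `ε` whenever the server leaves for the next queue. -/
noncomputable def lyapunov (p : Fin N → ℝ) (ε : ℝ) (y : State N × ℕ) : ℝ :=
  ∑ i, weight ε i y.1.loc * (y.1.queue i / p i) +
    (if y.1.travel = 0 then ε * N * (((y.1.queue y.1.loc : ℝ) - y.2) / p y.1.loc) else 0) +
    y.1.travel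

/-- During a visit, the gated packets are among those that are in the queue. -/
def GateValid (y : State N × ℕ) : Prop := y.1.travel = 0 → y.2 ≤ y.1.queue y.1.loc

variable {p : Fin N → ℝ} {ε : ℝ}

theorem lyapunov_of_travel_eq_zero_imp {y : State N × ℕ}
    (h : y.1.travel = 0 → y.2 = y.1.queue y.1.loc) :
    lyapunov p ε y = ∑ i, weight ε i y.1.loc * (y.1.queue i / p i) + y.1.travel := by
  unfold lyapunov
  split_ifs with h0
  · simp [h h0]
  · simp

section Bounds

variable (hp : ∀ i, 0 < p i) (hε : 0 ≤ ε)
include hp hε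

theorem mul_work_le_lyapunov {y : State N × ℕ} (hy : GateValid y) :
    (1 - ε) * ∑ i, (y.1.queue i : ℝ) / p i ≤ lyapunov p ε y := by
  have h1 : (1 - ε) * ∑ i, (y.1.queue i : ℝ) / p i ≤
      ∑ i, weight ε i y.1.loc * (y.1.queue i / p i) := by
    rw [Finset.mul_sum]
    exact Finset.sum_le_sum fun i _ => mul_le_mul_of_nonneg_right (le_weight hε _ _)
      (div_nonneg (Nat.cast_nonneg _) (hp i).le)
  have h2 : (0 : ℝ) ≤ if y.1.travel = 0 then
      ε * N * (((y.1.queue y.1.loc : ℝ) - y.2) / p y.1.loc) else 0 := by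
    split_ifs with h
    · have : (y.2 : ℝ) ≤ y.1.queue y.1.loc := by exact_mod_cast hy h
      exact mul_nonneg (by positivity) (div_nonneg (by linarith) (hp _).le)
    · exact le_rfl
  have h3 : (0 : ℝ) ≤ y.1.travel := Nat.cast_nonneg _
  unfold lyapunov
  linarith

theorem lyapunov_nonneg (hε' : ε ≤ 1) {y : State N × ℕ} (hy : GateValid y) : 0 ≤ lyapunov p ε y :=
  (mul_nonneg (by linarith) (Finset.sum_nonneg fun i _ =>
    div_nonneg (Nat.cast_nonneg _) (hp i).le)).trans (mul_work_le_lyapunov hp hε hy)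

theorem sum_weight_mul_add_le (q a : Fin N → ℕ) (j : Fin N) :
    ∑ i, weight ε i j * (((q i + a i : ℕ) : ℝ) / p i) ≤
      ∑ i, weight ε i j * (q i / p i) + (1 + ε * N) * ∑ i, (a i : ℝ) / p i := by
  rw [Finset.mul_sum, ← Finset.sum_add_distrib]
  refine Finset.sum_le_sum fun i _ => ?_
  have := mul_le_mul_of_nonneg_right (weight_le hε i j)
    (div_nonneg (Nat.cast_nonneg (a i)) (hp i).le)
  push_cast
  rw [add_div, mul_add]
  linarith

end Bounds

variable [NeZero N] (d : Fin N → Fin N → ℕ)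

theorem gatedStep_of_travel_pos {y : State N × ℕ} (h : 0 < y.1.travel) (a c : Fin N → ℕ) :
    (gatedStep d y a c).1 = ⟨fun i => y.1.queue i + a i, y.1.loc, y.1.travel - 1⟩ := by
  simp [gatedStep, step, h]

theorem gatedStep_of_gate_eq_zero {y : State N × ℕ} (h : y.1.travel = 0) (hg : y.2 = 0)
    (a c : Fin N → ℕ) :
    (gatedStep d y a c).1 =
      ⟨fun i => y.1.queue i + a i, y.1.loc + 1, d y.1.loc (y.1.loc + 1) - 1⟩ := by
  simp [gatedStep, step, h, hg, gatedAction]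

theorem gatedStep_of_gate_pos {y : State N × ℕ} (h : y.1.travel = 0) (hg : y.2 ≠ 0)
    (a c : Fin N → ℕ) :
    gatedStep d y a c =
      (⟨fun i => y.1.queue i - (if i = y.1.loc ∧ c i = 1 then 1 else 0) + a i, y.1.loc, 0⟩,
        if c y.1.loc = 1 then y.2 - 1 else y.2) := by
  simp [gatedStep, step, h, hg, gatedAction]

/-- On arrival every packet present is gated, so the term of `lyapunov` for ungated packets
vanishes. -/
theorem gatedStep_gate {y : State N × ℕ} (h : 0 < y.1.travel ∨ y.2 = 0) (a c : Fin N → ℕ)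
    (h0 : (gatedStep d y a c).1.travel = 0) :
    (gatedStep d y a c).2 = (gatedStep d y a c).1.queue (gatedStep d y a c).1.loc := by
  simp only [gatedStep] at h0 ⊢
  rw [if_pos h, if_pos h0]

theorem GateValid.gatedStep {y : State N × ℕ} (hy : GateValid y) (a c : Fin N → ℕ) :
    GateValid (gatedStep d y a c) := by
  intro h0
  by_cases h : 0 < y.1.travel ∨ y.2 = 0
  · exact (gatedStep_gate d h a c h0).le
  · push Not at h
    have ht : y.1.travel = 0 := by omega
    have := hy ht
    rw [gatedStep_of_gate_pos d ht h.2]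
    simp only [true_and]
    split_ifs <;> omega

theorem gateValid_gatedRun (q₀ : Fin N → ℕ) (i₀ : Fin N) (a c : Fin N → ℕ → ℕ) (t : ℕ) :
    GateValid (gatedRun d q₀ i₀ a c t) := by
  induction t with
  | zero => exact fun _ => le_rfl
  | succ t ih => exact ih.gatedStep d _ _

section Bounds

variable (hp : ∀ i, 0 < p i) (hε : 0 ≤ ε)
include hp hε

theorem lyapunov_gatedStep_of_travel_pos {y : State N × ℕ} (h : 0 < y.1.travel)
    (a c : Fin N → ℕ) :
    lyapunov p ε (gatedStep d y a c) ≤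
      lyapunov p ε y + (1 + ε * N) * ∑ i, (a i : ℝ) / p i - 1 := by
  rw [lyapunov_of_travel_eq_zero_imp (gatedStep_gate d (Or.inl h) a c),
    lyapunov_of_travel_eq_zero_imp (y := y) (fun h0 => absurd h0 h.ne'),
    gatedStep_of_travel_pos d h]
  have := sum_weight_mul_add_le hp hε y.1.queue a y.1.loc
  dsimp only
  rw [Nat.cast_sub (Nat.one_le_of_lt h)]
  push_cast at this ⊢
  linarith

theorem lyapunov_gatedStep_of_gate_pos {y : State N × ℕ} (hy : GateValid y)
    (h : y.1.travel = 0) (hg : y.2 ≠ 0) (a c : Fin N → ℕ) :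
    lyapunov p ε (gatedStep d y a c) ≤
      lyapunov p ε y + (1 + ε * N) * ∑ i, (a i : ℝ) / p i -
        (if c y.1.loc = 1 then (1 - ε) / p y.1.loc else 0) := by
  obtain ⟨⟨q, j, r⟩, g⟩ := y
  simp only at h hg
  subst h
  have hgq : g ≤ q j := hy rfl
  rw [gatedStep_of_gate_pos d rfl hg]
  simp only [lyapunov, if_true, true_and]
  -- `s` is the number of packets transmitted. It leaves both the queue and the gate, so the number
  -- of ungated packets changes only by the arrivals.
  set s : ℕ := if c j = 1 then 1 else 0 with hs
  have hsg : s ≤ g := by rw [hs]; split_ifs <;> omega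
  have hq : ∀ i, ((q i - (if i = j ∧ c i = 1 then 1 else 0) + a i : ℕ) : ℝ) =
      q i + a i - if i = j then (s : ℝ) else 0 := by
    intro i
    by_cases hij : i = j
    · subst hij
      rw [Nat.cast_add, Nat.cast_sub]
      · simp [hs]; ring
      · simp only [true_and]; exact hsg.trans hgq
    · simp [hij]
  have hg' : (if c j = 1 then g - 1 else g) = g - s := by
    rw [hs]; split_ifs <;> simp
  have hs' : (if c j = 1 then (1 - ε) / p j else 0) = (1 - ε) * (s / p j) := by
    rw [hs]; split_ifs <;> simp; ring
  rw [hg', hs', Nat.cast_sub hsg]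
  simp only [hq]
  have h1 : ∑ i, weight ε i j * (((q i : ℝ) + a i - if i = j then (s : ℝ) else 0) / p i) =
      ∑ i, weight ε i j * (q i / p i) + ∑ i, weight ε i j * (a i / p i)
        - (1 - ε) * (s / p j) := by
    have : (1 - ε) * ((s : ℝ) / p j) =
        ∑ i, weight ε i j * ((if i = j then (s : ℝ) else 0) / p i) := by
      rw [Finset.sum_eq_single j (fun i _ hi => by simp [hi]) (by simp), weight_self, if_pos rfl]
    rw [this, ← Finset.sum_add_distrib, ← Finset.sum_sub_distrib]
    exact Finset.sum_congr rfl fun i _ => by ring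
  -- Arrivals at the visited queue are ungated and enter two terms, with total weight `1 - ε + ε *
  -- N`.
  have h2 : ∑ i, weight ε i j * (a i / p i) + ε * N * (a j / p j) ≤
      (1 + ε * N) * ∑ i, (a i : ℝ) / p i := by
    have : ε * N * ((a j : ℝ) / p j) = ∑ i, (if i = j then ε * N else 0) * (a i / p i) := by
      simp [ite_mul]
    rw [this, ← Finset.sum_add_distrib, Finset.mul_sum]
    refine Finset.sum_le_sum fun i _ => ?_
    rw [← add_mul]
    refine mul_le_mul_of_nonneg_right ?_ (div_nonneg (Nat.cast_nonneg _) (hp i).le)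
    split_ifs with hij
    · rw [hij, weight_self]; linarith
    · simpa using weight_le hε i j
  rw [h1]
  have hqj : ((q j - s + a j : ℕ) : ℝ) = q j + a j - s := by
    rw [Nat.cast_add, Nat.cast_sub (hsg.trans hgq)]
    ring
  have h3 : ((q j : ℝ) + a j - s - (g - s)) / p j = (q j - g) / p j + a j / p j := by ring
  rw [hqj, h3]
  linarith

theorem lyapunov_gatedStep_of_gate_eq_zero {y : State N × ℕ}
    (h : y.1.travel = 0) (hg : y.2 = 0) (a c : Fin N → ℕ) :
    lyapunov p ε (gatedStep d y a c) ≤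
      lyapunov p ε y - ε * (∑ i, (y.1.queue i : ℝ) / p i) + (1 + ε * N) * ∑ i, (a i : ℝ) / p i +
        ∑ i, d i (i + 1) := by
  rw [lyapunov_of_travel_eq_zero_imp (gatedStep_gate d (Or.inr hg) a c),
    gatedStep_of_gate_eq_zero d h hg]
  have h1 := sum_weight_mul_add_le hp hε y.1.queue a (y.1.loc + 1)
  -- The jump `ε * N` in the weight of the queue being left is exactly what its packets, all ungated
  -- now, already carried in the second term.
  have h2 : ∑ i, weight ε i (y.1.loc + 1) * (y.1.queue i / p i) =
      lyapunov p ε y - ε * ∑ i, (y.1.queue i : ℝ) / p i := by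
    simp only [lyapunov, h, hg, if_true, weight_succ, Nat.cast_zero, sub_zero, add_zero]
    have : ε * N * ((y.1.queue y.1.loc : ℝ) / p y.1.loc) =
        ∑ i, (if i = y.1.loc then ε * N else 0) * (y.1.queue i / p i) := by
      simp [ite_mul]
    rw [this, Finset.mul_sum, ← Finset.sum_add_distrib, ← Finset.sum_sub_distrib]
    exact Finset.sum_congr rfl fun i _ => by ring
  have h3 : ((d y.1.loc (y.1.loc + 1) - 1 : ℕ) : ℝ) ≤ ∑ i, (d i (i + 1) : ℝ) := by
    refine le_trans (by exact_mod_cast Nat.sub_le _ _)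
      (Finset.single_le_sum (f := fun i => (d i (i + 1) : ℝ)) (fun i _ => Nat.cast_nonneg _)
        (Finset.mem_univ y.1.loc))
  dsimp only
  push_cast at h1 ⊢
  linarith

/-- This turns the gain `ε` times the work at a departure into a fixed fraction of the Lyapunov
function. -/
theorem lyapunov_le_mul_work {y : State N × ℕ} (h : y.1.travel = 0) (hg : y.2 = 0) :
    lyapunov p ε y ≤ (1 + ε * N) * ∑ i, (y.1.queue i : ℝ) / p i := by
  simp only [lyapunov, h, hg, if_true, Nat.cast_zero, sub_zero, add_zero]
  have : ε * N * ((y.1.queue y.1.loc : ℝ) / p y.1.loc) =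
      ∑ i, (if i = y.1.loc then ε * N else 0) * (y.1.queue i / p i) := by
    simp [ite_mul]
  rw [this, ← Finset.sum_add_distrib, Finset.mul_sum]
  refine Finset.sum_le_sum fun i _ => ?_
  rw [← add_mul]
  refine mul_le_mul_of_nonneg_right ?_ (div_nonneg (Nat.cast_nonneg _) (hp i).le)
  split_ifs with hij
  · rw [hij, weight_self]; linarith
  · simpa using weight_le hε i y.1.loc

end Bounds

end Lyapunov


/-! ### Quadratic drift and stability of the gated policy -/

section Stability

variable {Ω : Type*} {mΩ : MeasurableSpace Ω} {μ : Measure Ω} [IsProbabilityMeasure μ]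

/-- A bound on the second moment of a nonnegative random variable that is at most `h + U - v`. -/
theorem lintegral_ofReal_sq_le {U v f : Ω → ℝ} {h m K : ℝ} (hU : MemLp U 2 μ) (hv : MemLp v 2 μ)
    (hU0 : ∀ ω, 0 ≤ U ω) (hv0 : ∀ ω, 0 ≤ v ω) (hvK : ∀ ω, v ω ≤ K) (h0 : 0 ≤ h)
    (hf0 : ∀ ω, 0 ≤ f ω) (hf : ∀ ω, f ω ≤ h + U ω - v ω) (hm : ∫ ω, U ω ∂μ - ∫ ω, v ω ∂μ ≤ m) :
    ∃ r, 0 ≤ r ∧ r ≤ h ^ 2 + 2 * h * m + ∫ ω, U ω ^ 2 ∂μ + K ^ 2 ∧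
      ∫⁻ ω, ENNReal.ofReal (f ω ^ 2) ∂μ ≤ ENNReal.ofReal r := by
  have hUi : Integrable U μ := hU.integrable one_le_two
  have hvi : Integrable v μ := hv.integrable one_le_two
  have hle : ∀ ω, f ω ^ 2 ≤ 2 * h * (U ω - v ω) + U ω ^ 2 + (h ^ 2 + K ^ 2) := by
    intro ω
    have h1 : f ω ^ 2 ≤ (h + U ω - v ω) ^ 2 := pow_le_pow_left₀ (hf0 ω) (hf ω) 2
    have h2 : v ω ^ 2 ≤ K ^ 2 := pow_le_pow_left₀ (hv0 ω) (hvK ω) 2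
    -- Expanding the square, the cross term `-2 * U ω * v ω` is dropped.
    nlinarith [mul_nonneg (hU0 ω) (hv0 ω)]
  have hi1 : Integrable (fun ω => 2 * h * (U ω - v ω)) μ := (hUi.sub hvi).const_mul _
  have hi2 : Integrable (fun ω => U ω ^ 2) μ := hU.integrable_sq
  have hi3 : Integrable (fun ω => 2 * h * (U ω - v ω) + U ω ^ 2) μ := hi1.add hi2
  have hG0 : ∀ ω, 0 ≤ 2 * h * (U ω - v ω) + U ω ^ 2 + (h ^ 2 + K ^ 2) := fun ω =>
    (sq_nonneg _).trans (hle ω)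
  refine ⟨∫ ω, (2 * h * (U ω - v ω) + U ω ^ 2 + (h ^ 2 + K ^ 2)) ∂μ, integral_nonneg hG0, ?_, ?_⟩
  · rw [integral_add hi3 (integrable_const _), integral_add hi1 hi2,
      integral_const_mul, integral_sub hUi hvi]
    have := mul_le_mul_of_nonneg_left hm (by positivity : 0 ≤ 2 * h)
    simp only [integral_const, probReal_univ, one_smul]
    linarith
  · have hi4 : Integrable (fun ω => 2 * h * (U ω - v ω) + U ω ^ 2 + (h ^ 2 + K ^ 2)) μ :=
      hi3.add (integrable_const _)
    rw [ofReal_integral_eq_lintegral_ofReal hi4 (ae_of_all _ hG0)]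
    exact lintegral_mono fun ω => ENNReal.ofReal_le_ofReal (hle ω)

variable {N : ℕ} {lam p : Fin N → ℝ} {A C : Fin N → ℕ → Ω → ℕ}

omit [IsProbabilityMeasure μ] in
theorem IsModel.load_nonneg (h : IsModel μ lam p A C) (hp : ∀ i, 0 < p i) : 0 ≤ load lam p :=
  Finset.sum_nonneg fun i _ => div_nonneg (h.rate_nonneg i) (hp i).le

/-- The work that arrives in slot `t`. -/
noncomputable def arrivingWork (p : Fin N → ℝ) (A : Fin N → ℕ → Ω → ℕ) (t : ℕ) (ω : Ω) : ℝ :=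
  ∑ i, (A i t ω : ℝ) / p i

omit mΩ in
theorem arrivingWork_nonneg (hp : ∀ i, 0 < p i) (t : ℕ) (ω : Ω) : 0 ≤ arrivingWork p A t ω :=
  Finset.sum_nonneg fun i _ => div_nonneg (Nat.cast_nonneg _) (hp i).le

omit [IsProbabilityMeasure μ] in
theorem IsModel.memLp_arrivingWork (h : IsModel μ lam p A C) (t : ℕ) :
    MemLp (arrivingWork p A t) 2 μ :=
  memLp_finsetSum _ fun i _ => by
    simpa only [div_eq_mul_inv] using (h.memLp_arrival i t).mul_const (p i)⁻¹

theorem IsModel.integral_arrivingWork (h : IsModel μ lam p A C) (t : ℕ) :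
    ∫ ω, arrivingWork p A t ω ∂μ = load lam p := by
  unfold arrivingWork load
  rw [integral_finsetSum _ fun i _ => ((h.memLp_arrival i t).integrable one_le_two).div_const _]
  exact Finset.sum_congr rfl fun i _ => by rw [integral_div, h.mean_arrival]

omit [IsProbabilityMeasure μ] in
theorem IsModel.integral_arrivingWork_sq_le (h : IsModel μ lam p A C) (t : ℕ) :
    ∫ ω, arrivingWork p A t ω ^ 2 ∂μ ≤ N * ∑ i, (∫ ω, (A i 0 ω : ℝ) ^ 2 ∂μ) / p i ^ 2 := by
  have hi : ∀ i, Integrable (fun ω => ((A i t ω : ℝ) / p i) ^ 2) μ := fun i => by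
    simpa only [div_pow] using (h.memLp_arrival i t).integrable_sq.div_const _
  calc ∫ ω, arrivingWork p A t ω ^ 2 ∂μ ≤ ∫ ω, N * ∑ i, ((A i t ω : ℝ) / p i) ^ 2 ∂μ := by
        refine integral_mono (h.memLp_arrivingWork t).integrable_sq
          ((integrable_finsetSum _ fun i _ => hi i).const_mul _) fun ω => ?_
        simpa [arrivingWork] using
          sq_sum_le_card_mul_sum_sq (s := Finset.univ) (f := fun i => (A i t ω : ℝ) / p i)
    _ = N * ∑ i, (∫ ω, (A i 0 ω : ℝ) ^ 2 ∂μ) / p i ^ 2 := by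
        rw [integral_const_mul, integral_finsetSum _ fun i _ => hi i]
        congr 1
        refine Finset.sum_congr rfl fun i _ => ?_
        have := ((h.identDistrib_arrival i t).comp
          (measurable_of_countable fun n : ℕ => (n : ℝ) ^ 2)).integral_eq
        simp only [Function.comp_def] at this
        simp only [div_pow]
        rw [integral_div, this]

theorem exists_forall_quadratic_le {a : ℝ} (ha : 0 < a) (b c : ℝ) :
    ∃ B, 0 ≤ B ∧ ∀ x : ℝ, b * x + c ≤ a * x ^ 2 + B := by
  refine ⟨b ^ 2 / (4 * a) + |c|, by positivity, fun x => ?_⟩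
  have h1 : a * x ^ 2 + b ^ 2 / (4 * a) - b * x = (2 * a * x - b) ^ 2 / (4 * a) := by
    field_simp
    ring
  have h2 : 0 ≤ (2 * a * x - b) ^ 2 / (4 * a) := by positivity
  linarith [le_abs_self c]

variable [NeZero N]

/-- The weight increment of the Lyapunov function that suits the load. -/
noncomputable def weightStep (lam p : Fin N → ℝ) : ℝ := (1 - load lam p) / (4 * N)

/-- There are three cases: departure, service and travel. In the last two the mean drift of
`lyapunov` is at most `-(1 - load lam p) / 2`, and squaring doubles this coefficient. At a departure
contraction gives a negative quadratic term that absorbs all linear ones. `B` does not depend on `t`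
since the arrivals are identically distributed over time. -/
theorem IsModel.exists_drift (h : IsModel μ lam p A C) (hp : ∀ i, 0 < p i)
    (hload : load lam p < 1) (d : Fin N → Fin N → ℕ) :
    ∃ B : ℝ, ∀ (t : ℕ) (y : State N × ℕ), GateValid y →
      ∫⁻ ω, ENNReal.ofReal (lyapunov p (weightStep lam p)
          (gatedStep d y (fun i => A i t ω) (fun i => C i t ω)) ^ 2) ∂μ +
        ENNReal.ofReal ((1 - load lam p) * lyapunov p (weightStep lam p) y) ≤
      ENNReal.ofReal (lyapunov p (weightStep lam p) y ^ 2) + ENNReal.ofReal B := by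
  have hN : (0 : ℝ) < N := by exact_mod_cast Nat.pos_of_ne_zero (NeZero.ne N)
  have hN1 : (1 : ℝ) ≤ N := by exact_mod_cast Nat.one_le_iff_ne_zero.2 (NeZero.ne N)
  have hl0 := h.load_nonneg hp
  set ε := weightStep lam p with hεdef
  set ρ := load lam p with hρ
  -- Half of the slack `1 - ρ` is spent: at most a quarter on the extra weight of arrivals, at most
  -- a quarter on the loss `ε` in service.
  have hεN : ε * N = (1 - ρ) / 4 := by
    rw [hεdef, weightStep, ← hρ]; field_simp
  have hε : 0 < ε := div_pos (by linarith) (by positivity)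
  have hε4 : ε ≤ (1 - ρ) / 4 := by
    rw [← hεN]; exact le_mul_of_one_le_right hε.le hN1
  have hε1 : ε ≤ 1 := by linarith
  set w := 1 + ε * N with hw
  have hw0 : 0 < w := by linarith
  have hwρ : w * ρ ≤ ρ + (1 - ρ) / 4 := by
    rw [hw, hεN]; nlinarith
  set K := 1 + ∑ i, 1 / p i with hK
  have hpK : ∀ i, 1 / p i ≤ K := fun i => by
    have := Finset.single_le_sum (f := fun i => 1 / p i)
      (fun i _ => (one_div_pos.2 (hp i)).le) (Finset.mem_univ i)
    linarith
  have hK1 : 1 ≤ K := by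
    have : 0 ≤ ∑ i, 1 / p i := Finset.sum_nonneg fun i _ => (one_div_pos.2 (hp i)).le
    linarith
  set D : ℝ := ∑ i, (d i (i + 1) : ℝ) with hD
  have hD0 : 0 ≤ D := Finset.sum_nonneg fun i _ => Nat.cast_nonneg _
  set S := w ^ 2 * (N * ∑ i, (∫ ω, (A i 0 ω : ℝ) ^ 2 ∂μ) / p i ^ 2) with hS
  -- The contraction factor at departures: the loss is `ε` times the work, and the work is at least
  -- `M / w`.
  set θ := 1 - ε / w with hθ
  have hεw : ε / w ≤ 1 := (div_le_one hw0).2 (by linarith)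
  have hεw0 : 0 < ε / w := div_pos hε hw0
  have hθ0 : 0 ≤ θ := by linarith
  have hθ1 : θ < 1 := by linarith
  obtain ⟨B, hB0, hB⟩ := exists_forall_quadratic_le (a := 1 - θ ^ 2) (by nlinarith)
    (2 * θ * D + 2 * θ * (w * ρ) + (1 - ρ)) (D ^ 2 + 2 * D * (w * ρ) + S + K ^ 2)
  refine ⟨B + (S + K ^ 2), fun t y hy => ?_⟩
  have hM0 := lyapunov_nonneg hp hε.le hε1 hy
  set M := lyapunov p ε y with hM
  have hS0 : 0 ≤ S := mul_nonneg (sq_nonneg w) (mul_nonneg hN.le (Finset.sum_nonneg fun i _ =>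
    div_nonneg (integral_nonneg fun ω => sq_nonneg _) (sq_nonneg _)))
  have hU : MemLp (fun ω => w * arrivingWork p A t ω) 2 μ := (h.memLp_arrivingWork t).const_mul w
  have hU0 : ∀ ω, 0 ≤ w * arrivingWork p A t ω := fun ω =>
    mul_nonneg hw0.le (arrivingWork_nonneg hp t ω)
  have hUint : ∫ ω, w * arrivingWork p A t ω ∂μ = w * ρ := by
    rw [integral_const_mul, h.integral_arrivingWork]
  have hUsq : ∫ ω, (w * arrivingWork p A t ω) ^ 2 ∂μ ≤ S := by
    simp only [mul_pow]
    rw [integral_const_mul]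
    exact mul_le_mul_of_nonneg_left (h.integral_arrivingWork_sq_le t) (sq_nonneg w)
  -- The common end of the cases: `h'` is the deterministic part, `v` the amount removed, `m` a
  -- bound on the mean net increment.
  have key : ∀ (v : Ω → ℝ) (h' m : ℝ), MemLp v 2 μ → (∀ ω, 0 ≤ v ω) → (∀ ω, v ω ≤ K) → 0 ≤ h' →
      (∀ ω, lyapunov p ε (gatedStep d y (fun i => A i t ω) (fun i => C i t ω)) ≤
        h' + w * arrivingWork p A t ω - v ω) →
      w * ρ - ∫ ω, v ω ∂μ ≤ m →
      h' ^ 2 + 2 * h' * m + S + K ^ 2 + (1 - ρ) * M ≤ M ^ 2 + (B + (S + K ^ 2)) →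
      ∫⁻ ω, ENNReal.ofReal (lyapunov p ε
          (gatedStep d y (fun i => A i t ω) (fun i => C i t ω)) ^ 2) ∂μ +
        ENNReal.ofReal ((1 - ρ) * M) ≤
      ENNReal.ofReal (M ^ 2) + ENNReal.ofReal (B + (S + K ^ 2)) := by
    intro v h' m hv hv0 hvK h0' hle hm hfin
    obtain ⟨r, hr0, hr, h1⟩ := lintegral_ofReal_sq_le hU hv hU0 hv0 hvK h0'
      (fun ω => lyapunov_nonneg hp hε.le hε1 (hy.gatedStep d _ _)) hle (hUint ▸ hm)
    refine (add_le_add_left h1 _).trans ?_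
    rw [← ENNReal.ofReal_add (sq_nonneg M) (by positivity),
      ← ENNReal.ofReal_add hr0 (mul_nonneg (by linarith) hM0)]
    exact ENNReal.ofReal_le_ofReal (by linarith)
  rcases Nat.eq_zero_or_pos y.1.travel with ht | ht
  · by_cases hg : y.2 = 0
    · refine key (fun _ => 0) (θ * M + D) (w * ρ) (memLp_const 0) (fun _ => le_rfl)
        (fun _ => by linarith) (by positivity) (fun ω => ?_) (by simp) ?_
      · have h1 := lyapunov_gatedStep_of_gate_eq_zero d hp hε.le ht hg (fun i => A i t ω)
          (fun i => C i t ω)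
        have h2 := lyapunov_le_mul_work hp hε.le ht hg
        have h3 : ε / w * M ≤ ε * ∑ i, (y.1.queue i : ℝ) / p i := by
          rw [div_mul_eq_mul_div, div_le_iff₀ hw0, mul_assoc]
          refine mul_le_mul_of_nonneg_left ?_ hε.le
          rw [mul_comm]; exact h2
        push_cast at h1
        unfold arrivingWork
        rw [hθ]
        linarith
      · have := hB M
        nlinarith
    · set b := (1 - ε) / p y.1.loc with hb
      have hb0 : 0 ≤ b := div_nonneg (by linarith) (hp _).le
      have hbK : b ≤ K := (div_le_div_of_nonneg_right (by linarith) (hp _).le).trans (hpK _)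
      have hon : MeasurableSet {ω | C y.1.loc t ω = 1} :=
        h.measurable_channel _ t (measurableSet_singleton 1)
      have hv : (fun ω => if C y.1.loc t ω = 1 then b else 0) =
          {ω | C y.1.loc t ω = 1}.indicator fun _ => b := by
        ext ω; simp [Set.indicator]
      refine key (fun ω => if C y.1.loc t ω = 1 then b else 0) M (-(1 - ρ) / 2)
        ?_ (fun ω => ?_) (fun ω => ?_) hM0
        (fun ω => lyapunov_gatedStep_of_gate_pos d hp hε.le hy ht hg _ _) ?_ (by linarith)
      · rw [hv]
        exact (memLp_const b).indicator hon
      · positivity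
      · split_ifs <;> linarith
      -- The success probability cancels the work per packet, leaving mean service `1 - ε`.
      · rw [hv, integral_indicator_const _ hon, h.prob_on, smul_eq_mul, hb,
          mul_div_cancel₀ _ (hp _).ne']
        linarith
  · refine key (fun _ => 1) M (-(1 - ρ) / 2) (memLp_const 1) (fun _ => zero_le_one)
      (fun _ => hK1) hM0 (fun ω => ?_) ?_ (by linarith)
    · exact lyapunov_gatedStep_of_travel_pos d hp hε.le ht _ _
    · simp; linarith

/-- The quadratic drift is integrated over the current state and summed over time; queue lengths are
dominated by work, hence by the Lyapunov function. -/
theorem IsModel.stronglyStable_gated (h : IsModel μ lam p A C) (hp : ∀ i, 0 < p i ∧ p i ≤ 1)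
    (hload : load lam p < 1) (d : Fin N → Fin N → ℕ) (q₀ : Fin N → ℕ) (i₀ : Fin N) (i : Fin N) :
    StronglyStable μ fun t ω =>
      (gatedRun d q₀ i₀ (fun j s => A j s ω) (fun j s => C j s ω) t).1.queue i := by
  obtain ⟨B, hB⟩ := h.exists_drift (fun i => (hp i).1) hload d
  have hN1 : (1 : ℝ) ≤ N := by exact_mod_cast Nat.one_le_iff_ne_zero.2 (NeZero.ne N)
  have hl0 := h.load_nonneg fun i => (hp i).1
  set ε := weightStep lam p with hεdef
  set ρ := load lam p with hρ
  have hε : 0 ≤ ε := div_nonneg (by linarith) (by positivity)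
  have hε4 : ε ≤ 1 / 4 := by
    rw [hεdef, weightStep, div_le_div_iff₀ (by positivity) (by norm_num)]
    linarith
  let Y : ℕ → Ω → State N × ℕ := fun t ω =>
    gatedRun d q₀ i₀ (fun j s => A j s ω) (fun j s => C j s ω) t
  have hYv : ∀ t ω, GateValid (Y t ω) := fun t ω => gateValid_gatedRun d q₀ i₀ _ _ t
  have hYm : ∀ t, Measurable (Y t) := fun t =>
    (measurable_gatedRun A C d q₀ i₀ t).mono (h.pastInfo_le t) le_rfl
  let e : ℕ → ℝ≥0∞ := fun t => ∫⁻ ω, ENNReal.ofReal (lyapunov p ε (Y t ω) ^ 2) ∂μ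
  let m : ℕ → ℝ≥0∞ := fun t => ∫⁻ ω, ENNReal.ofReal ((1 - ρ) * lyapunov p ε (Y t ω)) ∂μ
  have hstep : ∀ t, e (t + 1) + m t ≤ e t + ENNReal.ofReal B := by
    intro t
    have hZm : Measurable (slotVar A C t) := (measurable_slotVar A C t).mono (h.slotInfo_le t) le_rfl
    have hind : IndepFun (Y t) (slotVar A C t) μ := by
      refine indep_of_indep_of_le_left (indep_of_indep_of_le_right (h.indep_pastInfo t) ?_) ?_
      · exact (measurable_slotVar A C t).comap_le.trans (le_iSup₂_of_le t le_rfl le_rfl)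
      · exact (measurable_gatedRun A C d q₀ i₀ t).comap_le
    have h1 : e (t + 1) = ∫⁻ ω, ∫⁻ ω', ENNReal.ofReal (lyapunov p ε
        (gatedStep d (Y t ω) (fun i => A i t ω') (fun i => C i t ω')) ^ 2) ∂μ ∂μ :=
      lintegral_comp_prodMk_of_indep (hYm t) hZm hind (f := fun z =>
        ENNReal.ofReal (lyapunov p ε (gatedStep d z.1 z.2.1 z.2.2) ^ 2)) Measurable.of_discrete
    have h2 : Measurable fun ω => ENNReal.ofReal ((1 - ρ) * lyapunov p ε (Y t ω)) :=
      (Measurable.of_discrete (f := fun y : State N × ℕ =>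
        ENNReal.ofReal ((1 - ρ) * lyapunov p ε y))).comp (hYm t)
    calc e (t + 1) + m t ≤
        ∫⁻ ω, (ENNReal.ofReal (lyapunov p ε (Y t ω) ^ 2) + ENNReal.ofReal B) ∂μ := by
          rw [h1, ← lintegral_add_right _ h2]
          exact lintegral_mono fun ω => hB t (Y t ω) (hYv t ω)
      _ = e t + ENNReal.ofReal B := by
          rw [lintegral_add_right _ measurable_const]
          simp [e]
  -- Telescoping without subtraction: `e T` stays on the left, so its finiteness is not needed.
  have hsum : ∀ T, ∑ t ∈ Finset.range T, m t + e T ≤ e 0 + T * ENNReal.ofReal B := by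
    intro T
    induction T with
    | zero => simp
    | succ T ih =>
      rw [Finset.sum_range_succ]
      calc ∑ t ∈ Finset.range T, m t + m T + e (T + 1)
          = ∑ t ∈ Finset.range T, m t + (e (T + 1) + m T) := by ring
        _ ≤ ∑ t ∈ Finset.range T, m t + (e T + ENNReal.ofReal B) :=
            add_le_add le_rfl (hstep T)
        _ = ∑ t ∈ Finset.range T, m t + e T + ENNReal.ofReal B := by ring
        _ ≤ e 0 + T * ENNReal.ofReal B + ENNReal.ofReal B := by gcongr
        _ = e 0 + ((T + 1 : ℕ) : ℝ≥0∞) * ENNReal.ofReal B := by push_cast; ring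
  have hQ : ∀ t, ∫⁻ ω, ((Y t ω).1.queue i : ℝ≥0∞) ∂μ ≤ ENNReal.ofReal (2 / (1 - ρ)) * m t := by
    intro t
    rw [← lintegral_const_mul' _ _ ENNReal.ofReal_ne_top]
    refine lintegral_mono fun ω => ?_
    rw [← ENNReal.ofReal_mul (div_nonneg zero_le_two (by linarith)), ← ENNReal.ofReal_natCast]
    refine ENNReal.ofReal_le_ofReal ?_
    have h1 := mul_work_le_lyapunov (fun i => (hp i).1) hε (hYv t ω)
    have h2 : ((Y t ω).1.queue i : ℝ) ≤ (Y t ω).1.queue i / p i :=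
      le_div_self (Nat.cast_nonneg _) (hp i).1 (hp i).2
    have h3 : ((Y t ω).1.queue i : ℝ) / p i ≤ ∑ j, ((Y t ω).1.queue j : ℝ) / p j :=
      Finset.single_le_sum (f := fun j => ((Y t ω).1.queue j : ℝ) / p j)
        (fun j _ => div_nonneg (Nat.cast_nonneg _) (hp j).1.le) (Finset.mem_univ i)
    have h4 : (0 : ℝ) ≤ (Y t ω).1.queue i := Nat.cast_nonneg _
    have h5 : (1 - ρ) ≠ 0 := by linarith
    have h6 : 2 / (1 - ρ) * ((1 - ρ) * lyapunov p ε (Y t ω)) = 2 * lyapunov p ε (Y t ω) := by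
      field_simp
    rw [h6]
    nlinarith
  have he0 : e 0 ≠ ⊤ := by simp [e, Y, gatedRun]
  refine lt_of_le_of_lt (limsup_le_of_le (by isBoundedDefault)
    (a := ENNReal.ofReal (2 / (1 - ρ)) * (e 0 + ENNReal.ofReal B)) ?_)
    (ENNReal.mul_lt_top ENNReal.ofReal_lt_top
      (ENNReal.add_lt_top.2 ⟨he0.lt_top, ENNReal.ofReal_lt_top⟩))
  filter_upwards [eventually_ge_atTop 1] with T hT
  refine ENNReal.div_le_of_le_mul ?_
  calc ∑ t ∈ Finset.range T, ∫⁻ ω, ((Y t ω).1.queue i : ℝ≥0∞) ∂μ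
      ≤ ∑ t ∈ Finset.range T, ENNReal.ofReal (2 / (1 - ρ)) * m t :=
        Finset.sum_le_sum fun t _ => hQ t
    _ ≤ ENNReal.ofReal (2 / (1 - ρ)) * (e 0 + T * ENNReal.ofReal B) := by
        rw [← Finset.mul_sum]
        gcongr
        exact le_self_add.trans (hsum T)
    _ ≤ ENNReal.ofReal (2 / (1 - ρ)) * ((e 0 + ENNReal.ofReal B) * T) := by
        gcongr
        rw [add_mul, mul_comm (T : ℝ≥0∞)]
        gcongr
        exact le_mul_of_one_le_right' (by exact_mod_cast hT)
    _ = _ := by ring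

end Stability


/-! ### Necessity of load at most one -/

section Converse

variable {N : ℕ} {Ω : Type*} {mΩ : MeasurableSpace Ω} {μ : Measure Ω} {lam p : Fin N → ℝ}
  {A C : Fin N → ℕ → Ω → ℕ}

theorem IsModel.lintegral_arrival (h : IsModel μ lam p A C) [IsFiniteMeasure μ] (i : Fin N)
    (t : ℕ) : ∫⁻ ω, (A i t ω : ℝ≥0∞) ∂μ = ENNReal.ofReal (lam i) := by
  rw [← h.mean_arrival i t, ofReal_integral_eq_lintegral_ofReal
    ((h.memLp_arrival i t).integrable one_le_two) (ae_of_all _ fun ω => Nat.cast_nonneg _)]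
  simp

/-- The movement of the server is determined by the actions. -/
theorem step_loc_travel_congr (d : Fin N → Fin N → ℕ) {x y : State N} {u : Option (Fin N)}
    (a c a' c' : Fin N → ℕ) (h : (x.loc, x.travel) = (y.loc, y.travel)) :
    ((step d x u a c).loc, (step d x u a c).travel) =
      ((step d y u a' c').loc, (step d y u a' c').travel) := by
  simp only [Prod.mk.injEq] at h
  unfold step
  rw [h.1, h.2]
  split_ifs
  · rfl
  · cases u <;> rfl

/-- An action may use the channels of its own slot, but it moves the server only from the next slot
on. Thus the position is known before the current channels are revealed. -/
theorem measurable_run_loc (d : Fin N → Fin N → ℕ) (q₀ : Fin N → ℕ) (i₀ : Fin N)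
    {u : ℕ → Ω → Option (Fin N)} {ℱ : Filtration ℕ mΩ}
    (hslot : ∀ s t, s < t → slotInfo A C s ≤ ℱ t)
    (hu : ∀ t v, MeasurableSet[ℱ t ⊔ channelInfo C t] {ω | u t ω = v}) (t : ℕ) :
    Measurable[ℱ t] fun ω =>
      let x := run d q₀ i₀ (fun s => u s ω) (fun j s => A j s ω) (fun j s => C j s ω) t
      (x.loc, x.travel) := by
  induction t with
  | zero => exact @measurable_const _ _ _ (ℱ 0) (i₀, 0)
  | succ t ih =>
    let _ := ℱ (t + 1)
    let _ : MeasurableSpace (Option (Fin N)) := ⊤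
    have : DiscreteMeasurableSpace (Option (Fin N)) := ⟨fun _ => trivial⟩
    have h1 := ih.mono (ℱ.mono (Nat.le_succ t)) le_rfl
    have hle : ℱ t ⊔ channelInfo C t ≤ ℱ (t + 1) :=
      sup_le (ℱ.mono (Nat.le_succ t)) (le_sup_right.trans (hslot t (t + 1) (Nat.lt_succ_self t)))
    have h2 : Measurable (u t) := measurable_to_countable' fun v => hle _ (hu t v)
    -- The server's motion ignores queues, arrivals and channels, so zeros stand in for them.
    have h3 := (Measurable.of_discrete (f := fun z : (Fin N × ℕ) × Option (Fin N) =>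
      let x := step d ⟨fun _ => 0, z.1.1, z.1.2⟩ z.2 (fun _ => 0) (fun _ => 0)
      (x.loc, x.travel))).comp (h1.prodMk h2)
    convert h3 using 2 with ω
    exact step_loc_travel_congr d _ _ _ _ rfl

/-- A departure is charged whenever `loc` is `i` and the channel is ON, even during a move or at an
empty queue. This overcount depends on the position only, not on the action. -/
theorem le_step_queue_add (d : Fin N → Fin N → ℕ) (x : State N) (u : Option (Fin N))
    (a c : Fin N → ℕ) (i : Fin N) :
    x.queue i + a i ≤ (step d x u a c).queue i + if x.loc = i ∧ c i = 1 then 1 else 0 := by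
  unfold step
  split_ifs with h1 h2 h2
  · simp
  · simp
  · cases u
    · simp [h2.1, h2.2]; omega
    · simp
  · cases u
    · have : ¬ (i = x.loc ∧ c i = 1) := fun h => h2 ⟨h.1.symm, h.2⟩
      simp [this]
    · simp

variable [IsProbabilityMeasure μ]

/-- Position and current channel are independent, so the charged departures have mean `p i` times
the probability of the position. -/
theorem IsModel.lintegral_queue_succ (h : IsModel μ lam p A C) (d : Fin N → Fin N → ℕ)
    (q₀ : Fin N → ℕ) (i₀ : Fin N) {u : ℕ → Ω → Option (Fin N)} (hu : IsControl μ A C u)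
    (t : ℕ) (i : Fin N) :
    let X : ℕ → Ω → State N := fun t ω =>
      run d q₀ i₀ (fun s => u s ω) (fun j s => A j s ω) (fun j s => C j s ω) t
    MeasurableSet {ω | (X t ω).loc = i} ∧
    ∫⁻ ω, ((X t ω).queue i : ℝ≥0∞) ∂μ + ENNReal.ofReal (lam i) ≤
      ∫⁻ ω, ((X (t + 1) ω).queue i : ℝ≥0∞) ∂μ +
        ENNReal.ofReal (p i) * μ {ω | (X t ω).loc = i} := by
  intro X
  obtain ⟨ℱ, hslot, hind, hum⟩ := hu
  have hloc : MeasurableSet[ℱ t] {ω | (X t ω).loc = i} :=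
    measurable_run_loc d q₀ i₀ hslot hum t
      (MeasurableSet.of_discrete (s := {z : Fin N × ℕ | z.1 = i}))
  have hon : MeasurableSet[slotInfo A C t] {ω | C i t ω = 1} :=
    measurable_channel_slotInfo A C i t (measurableSet_singleton 1)
  have hon' : MeasurableSet {ω | C i t ω = 1} := h.measurable_channel i t (measurableSet_singleton 1)
  have hinter := (Indep_iff _ _ μ).1 (hind t) _ _ hloc
    ((le_iSup₂_of_le (f := fun s (_ : t ≤ s) => slotInfo A C s) t le_rfl le_rfl) _ hon)
  have hloc' := ℱ.le t _ hloc
  refine ⟨hloc', ?_⟩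
  have hp : μ {ω | C i t ω = 1} = ENNReal.ofReal (p i) := by
    rw [← h.prob_on i t, ofReal_measureReal]
  have hmeas : Measurable fun ω => (A i t ω : ℝ≥0∞) :=
    (measurable_of_countable fun n : ℕ => (n : ℝ≥0∞)).comp (h.measurable_arrival i t)
  rw [mul_comm, ← hp, ← hinter, ← h.lintegral_arrival i t, ← lintegral_add_right _ hmeas,
    ← lintegral_indicator_one (hloc'.inter hon'),
    ← lintegral_add_right _ (measurable_one.indicator (hloc'.inter hon'))]
  refine lintegral_mono fun ω => ?_
  have := le_step_queue_add d (X t ω) (u t ω) (fun j => A j t ω) (fun j => C j t ω) i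
  have hind1 : ({ω | (X t ω).loc = i} ∩ {ω | C i t ω = 1}).indicator (1 : Ω → ℝ≥0∞) ω =
      ((if (X t ω).loc = i ∧ C i t ω = 1 then 1 else 0 : ℕ) : ℝ≥0∞) := by
    simp [Set.indicator]
  change _ ≤ _ + ({ω | (X t ω).loc = i} ∩ {ω | C i t ω = 1}).indicator (1 : Ω → ℝ≥0∞) ω
  rw [hind1]
  exact_mod_cast this

theorem IsModel.load_le_one_of_stabilizes (h : IsModel μ lam p A C) (hp : ∀ i, 0 < p i)
    (d : Fin N → Fin N → ℕ) (q₀ : Fin N → ℕ) (i₀ : Fin N) {u : ℕ → Ω → Option (Fin N)}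
    (hu : IsControl μ A C u) (hs : Stabilizes μ d q₀ i₀ A C u) : load lam p ≤ 1 := by
  by_contra! hload
  set ρ := load lam p with hρ
  have hlam := h.rate_nonneg
  let X : ℕ → Ω → State N := fun t ω =>
    run d q₀ i₀ (fun s => u s ω) (fun j s => A j s ω) (fun j s => C j s ω) t
  let E : Fin N → ℕ → ℝ≥0∞ := fun i t => ∫⁻ ω, ((X t ω).queue i : ℝ≥0∞) ∂μ
  let e : ℕ → ℝ≥0∞ := fun t => ∑ i, E i t / ENNReal.ofReal (p i)
  have hρe : ENNReal.ofReal ρ = ∑ i, ENNReal.ofReal (lam i) / ENNReal.ofReal (p i) := by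
    rw [hρ, load, ENNReal.ofReal_sum_of_nonneg fun i _ => div_nonneg (hlam i) (hp i).le]
    exact Finset.sum_congr rfl fun i _ => ENNReal.ofReal_div_of_pos (hp i)
  have hstep : ∀ t, e t + ENNReal.ofReal ρ ≤ e (t + 1) + 1 := by
    intro t
    -- `loc` is defined during moves too, so these events partition the space and at most one unit
    -- of mean work is removed.
    have h1 : ∑ i, μ {ω | (X t ω).loc = i} = 1 := by
      have hdisj : ((Finset.univ : Finset (Fin N)) : Set (Fin N)).PairwiseDisjoint
          fun i => {ω | (X t ω).loc = i} := fun i _ j _ hij =>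
        Set.disjoint_left.2 fun ω (h1 : _ = i) (h2 : _ = j) => hij (h1.symm.trans h2)
      rw [← measure_biUnion_finset hdisj
        fun i _ => (h.lintegral_queue_succ d q₀ i₀ hu t i).1]
      convert measure_univ (μ := μ)
      ext ω
      simp
    rw [← h1, hρe, ← Finset.sum_add_distrib, ← Finset.sum_add_distrib]
    refine Finset.sum_le_sum fun i _ => ?_
    have h0 : ENNReal.ofReal (p i) ≠ 0 := by simpa using hp i
    have h2 := ENNReal.div_le_div_right (h.lintegral_queue_succ d q₀ i₀ hu t i).2
      (ENNReal.ofReal (p i))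
    rw [ENNReal.add_div, ENNReal.add_div, mul_comm (ENNReal.ofReal (p i)),
      ENNReal.mul_div_cancel_right h0 ENNReal.ofReal_ne_top] at h2
    exact h2
  have hgrow : ∀ t : ℕ, ENNReal.ofReal (t * (ρ - 1)) ≤ e t := by
    intro t
    induction t with
    | zero => simp
    | succ t ih =>
      have h1 := (add_le_add_left ih (ENNReal.ofReal ρ)).trans (hstep t)
      rw [← ENNReal.ofReal_add (mul_nonneg (Nat.cast_nonneg _) (by linarith)) (by linarith)] at h1
      have h2 : (t : ℝ) * (ρ - 1) + ρ = ((t + 1 : ℕ) : ℝ) * (ρ - 1) + 1 := by push_cast; ring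
      rw [h2, ENNReal.ofReal_add (mul_nonneg (Nat.cast_nonneg _) (by linarith)) zero_le_one,
        ENNReal.ofReal_one] at h1
      exact (ENNReal.add_le_add_iff_right ENNReal.one_ne_top).1 h1
  have hbound : ∀ i, ∃ K : ℝ, 0 ≤ K ∧
      ∀ᶠ T : ℕ in atTop, ∑ t ∈ Finset.range T, E i t ≤ ENNReal.ofReal (K * T) := by
    intro i
    obtain ⟨K, hK, hKtop⟩ := exists_between (hs i)
    refine ⟨K.toReal, ENNReal.toReal_nonneg, ?_⟩
    filter_upwards [eventually_lt_of_limsup_lt hK, eventually_ge_atTop 1] with T hT hT1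
    rw [ENNReal.ofReal_mul ENNReal.toReal_nonneg, ENNReal.ofReal_toReal hKtop.ne,
      ENNReal.ofReal_natCast]
    exact (ENNReal.div_le_iff_le_mul (Or.inl (by simp; omega))
      (Or.inl (ENNReal.natCast_ne_top T))).1 hT.le
  choose K hK0 hK using hbound
  set L := ∑ i, K i / p i with hL
  -- Summing the linear growth gives a quadratic lower bound, against the linear upper bound from
  -- stability.
  have hfinal : ∀ᶠ T : ℕ in atTop, (ρ - 1) * (T * (T - 1) / 2) ≤ L * T := by
    filter_upwards [eventually_all.2 hK, eventually_ge_atTop 1] with T hT hT1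
    have h1 : ENNReal.ofReal (∑ t ∈ Finset.range T, (t : ℝ) * (ρ - 1)) ≤
        ENNReal.ofReal (L * T) := by
      rw [ENNReal.ofReal_sum_of_nonneg
        fun t _ => mul_nonneg (Nat.cast_nonneg _) (by linarith), hL, Finset.sum_mul,
        ENNReal.ofReal_sum_of_nonneg
        fun i _ => mul_nonneg (div_nonneg (hK0 i) (hp i).le) (Nat.cast_nonneg _)]
      calc _ ≤ ∑ t ∈ Finset.range T, e t := Finset.sum_le_sum fun t _ => hgrow t
        _ = ∑ i, (∑ t ∈ Finset.range T, E i t) / ENNReal.ofReal (p i) := by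
            rw [Finset.sum_comm]
            simp only [div_eq_mul_inv, Finset.sum_mul]
        _ ≤ ∑ i, ENNReal.ofReal (K i * T) / ENNReal.ofReal (p i) :=
            Finset.sum_le_sum fun i _ => ENNReal.div_le_div_right (hT i) _
        _ = _ := Finset.sum_congr rfl fun i _ => by
            rw [← ENNReal.ofReal_div_of_pos (hp i), div_mul_eq_mul_div]
    have hL0 : 0 ≤ L * T := mul_nonneg
      (Finset.sum_nonneg fun i _ => div_nonneg (hK0 i) (hp i).le) (Nat.cast_nonneg _)
    have h2 := (ENNReal.ofReal_le_ofReal_iff hL0).1 h1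
    have h3 : ∑ t ∈ Finset.range T, (t : ℝ) = T * (T - 1) / 2 := by
      have := Finset.sum_range_id_mul_two T
      have h4 : ((∑ t ∈ Finset.range T, t : ℕ) : ℝ) * 2 = T * ((T - 1 : ℕ) : ℝ) := by
        exact_mod_cast this
      rw [Nat.cast_sub hT1] at h4
      push_cast at h4
      linarith
    rw [← Finset.sum_mul, h3] at h2
    linarith
  obtain ⟨T₀, hT₀⟩ := exists_nat_gt (2 * L / (ρ - 1) + 1)
  obtain ⟨T, hT, hTT, hT1⟩ :=
    (hfinal.and ((eventually_ge_atTop T₀).and (eventually_ge_atTop 1))).exists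
  have hT1' : (1 : ℝ) ≤ T := by exact_mod_cast hT1
  have h1 : 2 * L / (ρ - 1) < T - 1 := by
    have : (T₀ : ℝ) ≤ T := by exact_mod_cast hTT
    linarith
  rw [div_lt_iff₀ (by linarith)] at h1
  nlinarith

end Converse


/-! ### Existence of models and the stability region -/

section Region

variable {N : ℕ}

/-- For all rates there is a model: in each slot, queue `i` receives either no packets or a fixed
number of packets. -/
theorem exists_isModel {lam p : Fin N → ℝ} (hlam : ∀ i, 0 ≤ lam i)
    (hp : ∀ i, 0 ≤ p i ∧ p i ≤ 1) :
    ∃ (Ω : Type) (_ : MeasurableSpace Ω) (μ : Measure Ω) (A C : Fin N → ℕ → Ω → ℕ),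
      IsProbabilityMeasure μ ∧ IsModel μ lam p A C := by
  -- The batch size; adding one keeps it positive when the rate is zero.
  let n : Fin N → ℕ := fun i => ⌈lam i⌉₊ + 1
  have hn0 : ∀ i, (0 : ℝ) < n i := fun i => by positivity
  have hn : ∀ i, lam i / n i ≤ 1 := fun i => by
    rw [div_le_one (hn0 i)]
    simp only [n]
    push_cast
    linarith [Nat.le_ceil (lam i)]
  let r : (Fin N × ℕ) ⊕ (Fin N × ℕ) → unitInterval :=
    Sum.elim (fun k => ⟨lam k.1 / n k.1, div_nonneg (hlam _) (hn0 _).le, hn _⟩)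
      (fun k => ⟨p k.1, hp k.1⟩)
  let v : (Fin N × ℕ) ⊕ (Fin N × ℕ) → ℕ := Sum.elim (fun k => n k.1) (fun _ => 1)
  let ν : (Fin N × ℕ) ⊕ (Fin N × ℕ) → Measure Bool := fun k => bernoulliMeasure true false (r k)
  let μ := Measure.infinitePi ν
  let X : (Fin N × ℕ) ⊕ (Fin N × ℕ) → (((Fin N × ℕ) ⊕ (Fin N × ℕ)) → Bool) → ℕ :=
    fun k ω => bif ω k then v k else 0
  have hev : ∀ k, Measurable fun ω : ((Fin N × ℕ) ⊕ (Fin N × ℕ)) → Bool => ω k := fun k =>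
    measurable_pi_apply k
  have hXm : ∀ k, Measurable (X k) := fun k =>
    (Measurable.of_discrete (f := fun b : Bool => bif b then v k else 0)).comp (hev k)
  have hmap : ∀ k, μ.map (fun ω => ω k) = ν k := fun k => Measure.infinitePi_map_eval ν k
  have hident : ∀ k l, r k = r l → v k = v l → IdentDistrib (X k) (X l) μ μ := by
    intro k l hr hv
    have h1 : IdentDistrib (fun ω : ((Fin N × ℕ) ⊕ (Fin N × ℕ)) → Bool => ω k) (fun ω => ω l) μ μ :=
      ⟨(hev k).aemeasurable, (hev l).aemeasurable, by
        rw [hmap, hmap]; simp only [ν, hr]⟩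
    have h2 := h1.comp (Measurable.of_discrete (f := fun b : Bool => bif b then v k else 0))
    have h3 : X l = (fun b : Bool => bif b then v k else 0) ∘ fun ω => ω l := by
      funext ω
      simp only [X, Function.comp, hv]
    rw [h3]
    exact h2
  have hmean : ∀ k, ∫ ω, (X k ω : ℝ) ∂μ = r k * v k := by
    intro k
    have h1 : ∫ ω, (X k ω : ℝ) ∂μ = ∫ b, ((bif b then v k else 0 : ℕ) : ℝ) ∂(μ.map fun ω => ω k) :=
      (integral_map (hev k).aemeasurable
        (f := fun b : Bool => ((bif b then v k else 0 : ℕ) : ℝ))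
        Measurable.of_discrete.aestronglyMeasurable).symm
    rw [h1, hmap, integral_bernoulliMeasure]
    simp
  refine ⟨_, inferInstance, μ, fun i t => X (Sum.inl (i, t)), fun i t => X (Sum.inr (i, t)),
    inferInstance, fun i t => hXm _, fun i t => hXm _, ?_, fun i t => hident _ _ rfl rfl,
    fun i t => ?_, fun i t => ?_, fun i t ω => ?_, fun i t => ?_⟩
  · have h1 := iIndepFun_infinitePi (P := ν) (X := fun k (b : Bool) => bif b then v k else 0)
      fun k => Measurable.of_discrete
    convert h1 using 1
    ext k ω
    cases k <;> rfl
  · refine MemLp.of_bound (C := n i)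
      ((measurable_of_countable fun m : ℕ => (m : ℝ)).comp (hXm _)).aestronglyMeasurable
      (ae_of_all _ fun ω => ?_)
    simp only [X]
    cases ω (Sum.inl (i, t)) <;> simp [v]
  · rw [hmean]
    exact div_mul_cancel₀ _ (hn0 i).ne'
  · simp only [X]
    cases ω (Sum.inr (i, t)) <;> simp [v]
  · have h1 : {ω | X (Sum.inr (i, t)) ω = 1} = (fun ω => ω (Sum.inr (i, t))) ⁻¹' {true} := by
      ext ω
      simp only [X, Set.mem_ofPred_eq, Set.mem_preimage, Set.mem_singleton_iff]
      cases ω (Sum.inr (i, t)) <;> simp [v]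
    rw [h1, ← map_measureReal_apply (hev _) (measurableSet_singleton true), hmap,
      bernoulliMeasure_real_apply_of_mem_of_notMem _ (measurableSet_singleton _) rfl (by simp)]
    rfl

theorem load_smul (s : ℝ) (lam p : Fin N → ℝ) : load (s • lam) p = s * load lam p := by
  simp only [load, Finset.mul_sum, Pi.smul_apply, smul_eq_mul, mul_div_assoc]

variable [NeZero N] {p : Fin N → ℝ}

theorem IsModel.stabilizes_gatedControl {Ω : Type*} [MeasurableSpace Ω] {μ : Measure Ω}
    [IsProbabilityMeasure μ] {lam : Fin N → ℝ} {A C : Fin N → ℕ → Ω → ℕ}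
    (h : IsModel μ lam p A C) (hp : ∀ i, 0 < p i ∧ p i ≤ 1) (hload : load lam p < 1)
    (d : Fin N → Fin N → ℕ) (q₀ : Fin N → ℕ) (i₀ : Fin N) :
    Stabilizes μ d q₀ i₀ A C (fun t ω =>
      gatedControl d q₀ i₀ (fun i s => A i s ω) (fun i s => C i s ω) t) := by
  intro i
  simpa only [run_gatedControl] using h.stronglyStable_gated hp hload d q₀ i₀ i

/-- The right side is closed, and it contains the region by necessity applied to one model; without
`exists_isModel` membership could be vacuous. Conversely, shrinking a rate vector slightly makes its
load less than one. -/
theorem closure_stabilityRegion (hp : ∀ i, 0 < p i ∧ p i ≤ 1) (d : Fin N → Fin N → ℕ) :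
    closure (stabilityRegion p d) = {lam | (∀ i, 0 ≤ lam i) ∧ load lam p ≤ 1} := by
  apply Set.Subset.antisymm
  · refine closure_minimal ?_ ?_
    · rintro lam ⟨hlam, hreg⟩
      obtain ⟨Ω, _, μ, A, C, _, hmodel⟩ := exists_isModel hlam fun i => ⟨(hp i).1.le, (hp i).2⟩
      obtain ⟨u, hu, hs⟩ := hreg Ω μ A C hmodel (fun _ => 0) 0
      exact ⟨hlam, hmodel.load_le_one_of_stabilizes (fun i => (hp i).1) d _ _ hu hs⟩
    · have h1 : IsClosed {lam : Fin N → ℝ | ∀ i, 0 ≤ lam i} := by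
        rw [Set.ofPred_forall]
        exact isClosed_iInter fun i => isClosed_le continuous_const (continuous_apply i)
      have h2 : IsClosed {lam : Fin N → ℝ | load lam p ≤ 1} :=
        isClosed_le (continuous_finsetSum _ fun i _ => (continuous_apply i).div_const _)
          continuous_const
      exact h1.inter h2
  · rintro lam ⟨hlam, hload⟩
    have htend : Tendsto (fun n : ℕ => (1 - 1 / ((n : ℝ) + 1)) • lam) atTop (nhds lam) := by
      have h1 := (tendsto_const_nhds (x := (1 : ℝ))).sub (tendsto_one_div_add_atTop_nhds_zero_nat (𝕜 := ℝ))
      simpa using h1.smul_const lam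
    refine mem_closure_of_tendsto htend (Eventually.of_forall fun n => ?_)
    have hn : 0 < 1 / ((n : ℝ) + 1) := by positivity
    have hn1 : 1 / ((n : ℝ) + 1) ≤ 1 :=
      (div_le_one (by positivity)).2 (by linarith [(Nat.cast_nonneg n : (0 : ℝ) ≤ n)])
    have hl : load ((1 - 1 / ((n : ℝ) + 1)) • lam) p < 1 := by
      rw [load_smul]
      nlinarith
    refine ⟨fun i => mul_nonneg (by linarith) (hlam i), fun Ω _ μ _ A C h q₀ i₀ =>
      ⟨_, h.isControl_gatedControl d q₀ i₀, h.stabilizes_gatedControl hp hl d q₀ i₀⟩⟩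

end Region

end SwitchedQueues

theorem mainTheorem4 {N : ℕ} [NeZero N] (p : Fin N → ℝ) (hp : ∀ i, 0 < p i ∧ p i ≤ 1)
    (d : Fin N → Fin N → ℕ) (hd : ∀ i j, i ≠ j → 1 ≤ d i j) :
    (∀ (Ω : Type*) [MeasurableSpace Ω] (μ : Measure Ω) [IsProbabilityMeasure μ]
      (lam : Fin N → ℝ) (A C : Fin N → ℕ → Ω → ℕ),
      SwitchedQueues.IsModel μ lam p A C →
      ∀ (q₀ : Fin N → ℕ) (i₀ : Fin N),
        -- the cyclic gated policy stabilizes the system whenever the load is less than one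
        (SwitchedQueues.load lam p < 1 →
          SwitchedQueues.IsControl μ A C (fun t ω => SwitchedQueues.gatedControl d q₀ i₀
            (fun i s => A i s ω) (fun i s => C i s ω) t) ∧
          SwitchedQueues.Stabilizes μ d q₀ i₀ A C (fun t ω => SwitchedQueues.gatedControl d q₀ i₀
            (fun i s => A i s ω) (fun i s => C i s ω) t)) ∧
        -- no control algorithm stabilizes the system if the load exceeds one
        (∀ u : ℕ → Ω → Option (Fin N), SwitchedQueues.IsControl μ A C u →
          SwitchedQueues.Stabilizes μ d q₀ i₀ A C u → SwitchedQueues.load lam p ≤ 1)) ∧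
    -- the stability region, up to its boundary
    closure (SwitchedQueues.stabilityRegion p d) =
      {lam | (∀ i, 0 ≤ lam i) ∧ SwitchedQueues.load lam p ≤ 1} :=
  ⟨fun _ _ _ _ _ _ _ h q₀ i₀ =>
    ⟨fun hload => ⟨h.isControl_gatedControl d q₀ i₀, h.stabilizes_gatedControl hp hload d q₀ i₀⟩,
      fun _ hu hs => h.load_le_one_of_stabilizes (fun i => (hp i).1) d q₀ i₀ hu hs⟩,
    SwitchedQueues.closure_stabilityRegion hp d⟩
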